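/- Let $c,\lambda_b>0$ and $\alpha>2$ (in the intended application $c=5/4$, $\lambda_b$ is the base-station intensity and $\alpha$ the path-loss exponent). Let the distances of $2K$ users to their common serving base station be independent with the Rayleigh density $f_d(x)=2c\lambda_b\pi x\,e^{-c\lambda_b\pi x^2}$, $x\ge 0$, and distribution function $F_d$. Group the users into $K$ pairs uniformly at random, independently of the distances, and let $d_k$ be the smaller of the two distances in pair $k$ (the distance of the near user). Then $d_k$ has the density $$f_{d_k}(x)=2\,(1-F_d(x))\,f_d(x).$$ Let $\mathbf u_k\in\mathbb C^N\setminus\{0\}$ (the receive filter), $P>0$ (transmit power), $\rho_I\ge 0$ (interference power), $\sigma>0$ (noise level), and let $\ell(d)=d^{-\alpha}$, $\sigma_k^2=\sigma^2\|\mathbf u_k\|^2$ and $\omega_k=\Gamma(1-\tfrac2\alpha)\bigl(\tfrac{\rho_I}{P}|\mathbf u_k^{\mathrm H}\mathbf 1_N|^2\bigr)^{2/\alpha}$. For $s,t\in\mathbb C$ with positive real parts put $$\varphi_k(s+t)=\mathbb E\Bigl\{\exp\Bigl(-\frac{\sigma_k^2}{P\,\ell(d_k)}(s+t)-\pi\lambda_b\,\omega_k\,d_k^2\,(s+t)^{2/\alpha}\Bigr)\Bigr\}$$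 (principal powers). This expectation exists, and $$\varphi_k(s+t)=\frac{2c}{2c+\omega_k(s+t)^{2/\alpha}}\;H^{1,1}_{1,1}\!\left(\frac{\sigma_k^2}{P}(s+t)\bigl(\pi\lambda_b(2c+\omega_k(s+t)^{2/\alpha})\bigr)^{-\alpha/2}\,\middle|\begin{array}{c}(0,\frac\alpha2)\\(0,1)\end{array}\right),$$ where $H^{1,1}_{1,1}$ is Fox's H-function, here $$H^{1,1}_{1,1}\!\left(z\,\middle|\begin{array}{c}(0,\frac\alpha2)\\(0,1)\end{array}\right)=\frac1{2\pi\mathrm i}\int_{\gamma-\mathrm i\infty}^{\gamma+\mathrm i\infty}\Gamma(v)\,\Gamma\bigl(1-\tfrac\alpha2v\bigr)\,z^{-v}\,dv ,$$ the integral converging absolutely and having the same value for every $\gamma$ for which the line $\mathrm{Re}\,v=\gamma$ separates the poles of the two Gamma factors. In the interference-limited regime: for fixed $s$, $t$, $\mathbf u_k$, $c$, $\lambda_b$, $\alpha$ and along any family of parameters $P>0$, $\rho_I\ge0$, $\sigma$ with $\sigma^2/P\to 0$, $$\varphi_k(s+t)\sim\frac{2c}{2c+\omega_k(s+t)^{2/\alpha}}$$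 (the ratio of the two sides tends to $1$), and if $\omega_k$ is constant along the family, then $\varphi_k(s+t)$ converges to the right-hand side. -/

import Mathlib

open MeasureTheory ProbabilityTheory Filter Topology Asymptotics
open scoped ENNReal

noncomputable section

namespace NomaNearUser

/-! ### Fox's H-function -/

/-- The Mellin transform of the Fox H-function `H^{m,n}_{p,q}` whose upper parameters are the pairs
`a j = (a_j, A_j)` and whose lower parameters are the pairs `b j = (b_j, B_j)`. A factor `1 / Γ` has
the value `0` at a pole of `Γ`, both in Lean and in mathematics. -/
def foxKernel (m n : ℕ) {p q : ℕ} (a : Fin p → ℂ × ℝ) (b : Fin q → ℂ × ℝ) (s : ℂ) : ℂ :=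
  (∏ j : Fin q, if j.val < m then Complex.Gamma ((b j).1 + (b j).2 * s)
      else (Complex.Gamma (1 - (b j).1 - (b j).2 * s))⁻¹) *
  (∏ j : Fin p, if j.val < n then Complex.Gamma (1 - (a j).1 - (a j).2 * s)
      else (Complex.Gamma ((a j).1 + (a j).2 * s))⁻¹)

/-- The vertical line `Re s = γ` has all the poles `-(b_j + ν) / B_j`, `j ≤ m`, on its left and all
the poles `(1 - a_j + ν) / A_j`, `j ≤ n`, on its right. -/
def FoxSeparates (m n : ℕ) {p q : ℕ} (a : Fin p → ℂ × ℝ) (b : Fin q → ℂ × ℝ) (γ : ℝ) : Prop :=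
  (∀ j : Fin q, j.val < m → ∀ ν : ℕ, (-((b j).1 + (ν : ℂ)) / ((b j).2 : ℂ)).re < γ) ∧
  (∀ j : Fin p, j.val < n → ∀ ν : ℕ, γ < ((1 - (a j).1 + (ν : ℂ)) / ((a j).2 : ℂ)).re)

/-- The integrand of the Mellin-Barnes integral at the point `γ + i y` of the line `Re s = γ`. -/
def foxIntegrand (m n : ℕ) {p q : ℕ} (a : Fin p → ℂ × ℝ) (b : Fin q → ℂ × ℝ) (γ : ℝ) (z : ℂ)
    (y : ℝ) : ℂ :=
  foxKernel m n a b ((γ : ℂ) + (y : ℂ) * Complex.I) * z ^ (-((γ : ℂ) + (y : ℂ) * Complex.I))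

/-- The Mellin-Barnes integral `(2πi)⁻¹ ∫ Θ(s) z^{-s} ds` along the upward line `Re s = γ`,
parametrised by `s = γ + i y`. -/
def foxLine (m n : ℕ) {p q : ℕ} (a : Fin p → ℂ × ℝ) (b : Fin q → ℂ × ℝ) (γ : ℝ) (z : ℂ) : ℂ :=
  (1 / (2 * (Real.pi : ℂ))) * ∫ y : ℝ, foxIntegrand m n a b γ z y

open Classical in
/-- Fox's H-function `H^{m,n}_{p,q}(z | a ; b)`: the Mellin-Barnes integral along a vertical line
that separates the two families of poles. -/
def foxH (m n : ℕ) {p q : ℕ} (a : Fin p → ℂ × ℝ) (b : Fin q → ℂ × ℝ) (z : ℂ) : ℂ :=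
  if h : ∃ γ : ℝ, FoxSeparates m n a b γ then foxLine m n a b h.choose z else 0

/-! ### User distances and random grouping -/

/-- The Rayleigh density `f_d` of the distance between a user and its serving base station. -/
def fd (c lam : ℝ) (x : ℝ) : ℝ :=
  if 0 ≤ x then 2 * c * lam * Real.pi * x * Real.exp (-(c * lam * Real.pi * x ^ 2)) else 0

/-- The law of the distance between a user and its serving base station. -/
def distLaw (c lam : ℝ) : Measure ℝ :=
  (volume : Measure ℝ).withDensity fun x => ENNReal.ofReal (fd c lam x)

/-- The cumulative distribution function `F_d` of that distance. -/
def Fd (c lam : ℝ) (x : ℝ) : ℝ := (distLaw c lam).real (Set.Iic x)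

/-- A grouping of `2K` users into `K` pairs: the members of pair `k` are the images of `(k, 0)` and
`(k, 1)`. -/
abbrev Grouping (K : ℕ) : Type := Fin K × Fin 2 ≃ Fin (2 * K)

instance instMeasurableSpaceGrouping (K : ℕ) : MeasurableSpace (Grouping K) := ⊤

/-- Random grouping: the `2K` users have independent distances `D i` with density `f_d`, and they
are grouped into pairs by a uniformly distributed grouping `g` that does not depend on the
distances. -/
structure IsRandomGrouping {Ω : Type*} [MeasurableSpace Ω] (μ : Measure Ω) (K : ℕ) (c lam : ℝ)
    (D : Fin (2 * K) → Ω → ℝ) (g : Ω → Grouping K) : Prop where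
  measurable_dist : ∀ i, Measurable (D i)
  law_dist : ∀ i, μ.map (D i) = distLaw c lam
  indep_dist : iIndepFun D μ
  measurable_grouping : Measurable g
  uniform_grouping : ∀ e : Grouping K, μ (g ⁻¹' {e}) = (((2 * K).factorial : ℕ) : ℝ≥0∞)⁻¹
  indep_grouping : IndepFun g (fun ω i => D i ω) μ

/-- The distance `d_k` of the near user of pair `k`. -/
def nearDist {Ω : Type*} {K : ℕ} (D : Fin (2 * K) → Ω → ℝ) (g : Ω → Grouping K) (k : Fin K)
    (ω : Ω) : ℝ :=
  min (D (g ω (k, 0)) ω) (D (g ω (k, 1)) ω)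

/-! ### The function `φ_k` -/

/-- The path loss `ℓ(d) = d^{-α}`. -/
def pathLoss (α d : ℝ) : ℝ := d ^ (-α)

/-- The filtered noise power `σ_k² = σ² ‖u_k‖²`. -/
def noisePower {N : ℕ} (σ : ℝ) (u : EuclideanSpace ℂ (Fin N)) : ℝ := σ ^ 2 * ‖u‖ ^ 2

/-- The coefficient `ω_k = Γ(1 - 2/α) ((ρ_I / P) |u_kᴴ 1|²)^{2/α}`. -/
def interfCoeff {N : ℕ} (α P ρI : ℝ) (u : EuclideanSpace ℂ (Fin N)) : ℝ :=
  Real.Gamma (1 - 2 / α) * (ρI / P * ‖∑ i, star (u i)‖ ^ 2) ^ (2 / α)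

/-- The random variable whose expectation is `φ_k(w)`, as a function of the distance `d = d_k`. -/
def phiIntegrand {N : ℕ} (lam α P ρI σ : ℝ) (u : EuclideanSpace ℂ (Fin N)) (w : ℂ) (d : ℝ) : ℂ :=
  Complex.exp (-((noisePower σ u / (P * pathLoss α d) : ℝ) : ℂ) * w
    - ((Real.pi * lam * interfCoeff α P ρI u * d ^ 2 : ℝ) : ℂ) * w ^ ((2 / α : ℝ) : ℂ))

/-- `φ_k(w) = 𝔼 exp(-σ_k² w / (P ℓ(d_k)) - π λ_b ω_k d_k² w^{2/α})`, where `d` is the random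
distance `d_k`. -/
def phi {Ω : Type*} [MeasurableSpace Ω] (μ : Measure Ω) (d : Ω → ℝ) {N : ℕ}
    (lam α P ρI σ : ℝ) (u : EuclideanSpace ℂ (Fin N)) (w : ℂ) : ℂ :=
  ∫ ω, phiIntegrand lam α P ρI σ u w (d ω) ∂μ

/-- The denominator `2c + ω w^{2/α}`. -/
def denom (c α coeff : ℝ) (w : ℂ) : ℂ :=
  2 * (c : ℂ) + (coeff : ℂ) * w ^ ((2 / α : ℝ) : ℂ)

/-- The argument `(σ_k² / P) w (π λ_b (2c + ω_k w^{2/α}))^{-α/2}` of the H-function. -/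
def foxArg {N : ℕ} (c lam α P ρI σ : ℝ) (u : EuclideanSpace ℂ (Fin N)) (w : ℂ) : ℂ :=
  ((noisePower σ u / P : ℝ) : ℂ) * w *
    (((Real.pi * lam : ℝ) : ℂ) * denom c α (interfCoeff α P ρI u) w) ^ ((-(α / 2) : ℝ) : ℂ)

end NomaNearUser

end

namespace NomaNearUser

/-! ### Gamma integrals with complex rate -/

/-! The Rayleigh tail is `exp (-c λ π x²)` for `x ≥ 0`. The minimum of two independent distances has
the square of this tail, so `d_k` is Rayleigh with `2c` in place of `c`; conditioning on the
grouping reduces to this case (`map_nearDist`).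

Put `w = s + t`, `β = α/2`, `B = (σ_k²/P) w` and `A = π λ (2c + ω_k w^{2/α})`. The substitution `r =
d²` turns the expectation into `2c/(2c + ω_k w^{2/α})` times `A ∫ exp (-B r^β - A r) dr` (`phi_eq`).
Writing `exp (-B r^β)` as a Cahen-Mellin integral and integrating over `r` first gives a
Mellin-Barnes integral (`integral_exp_eq_mellinBarnes`). It is the H-function at `B A^{-β}` as soon
as the principal powers combine, which needs `|arg B| + β |arg A| < π`. Adding a positive real to
`ω_k w^{2/α}` does not increase the modulus of the argument, so `β |arg A| ≤ |arg w| < π/2`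
(`abs_arg_denom_le`).

For the limit, `|e^{-z} - 1| ≤ |z|` on `Re z ≥ 0` shows that `A ∫ exp (-B r^β - A r) dr` differs
from `1` by at most a constant times `σ²/P`. The constant does not depend on `ω_k`
(`norm_laplace_sub_one_le`), so `P` and `ρ_I` may vary freely. -/

theorem integrableOn_rpow_mul_exp_neg_mul {a r : ℝ} (ha : -1 < a) (hr : 0 < r) :
    IntegrableOn (fun t : ℝ => t ^ a * Real.exp (-(r * t))) (Set.Ioi 0) := by
  simpa using integrableOn_rpow_mul_exp_neg_mul_rpow ha one_pos hr

theorem norm_cpow_mul_exp_neg_mul {s r : ℂ} {t : ℝ} (ht : 0 < t) :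
    ‖(t : ℂ) ^ (s - 1) * Complex.exp (-(r * t))‖ =
      t ^ (s.re - 1) * Real.exp (-(r.re * t)) := by
  rw [norm_mul, Complex.norm_cpow_eq_rpow_re_of_pos ht, Complex.norm_exp]
  simp

theorem aestronglyMeasurable_cpow_mul_exp (s r : ℂ) :
    AEStronglyMeasurable (fun t : ℝ => (t : ℂ) ^ (s - 1) * Complex.exp (-(r * t)))
      (volume.restrict (Set.Ioi 0)) := by
  refine ContinuousOn.aestronglyMeasurable (fun t ht => ?_) measurableSet_Ioi
  have : (t : ℂ) ∈ Complex.slitPlane := Complex.ofReal_mem_slitPlane.2 ht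
  refine ContinuousAt.continuousWithinAt (ContinuousAt.mul ?_ (by fun_prop))
  exact (continuousAt_cpow_const this).comp Complex.continuous_ofReal.continuousAt

theorem integrableOn_cpow_mul_exp_neg_mul {s r : ℂ} (hs : 0 < s.re) (hr : 0 < r.re) :
    IntegrableOn (fun t : ℝ => (t : ℂ) ^ (s - 1) * Complex.exp (-(r * t))) (Set.Ioi 0) := by
  refine (integrableOn_rpow_mul_exp_neg_mul (a := s.re - 1) (by linarith) hr).mono'
    (aestronglyMeasurable_cpow_mul_exp s r) ?_
  filter_upwards [ae_restrict_mem measurableSet_Ioi] with t ht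
  exact (norm_cpow_mul_exp_neg_mul ht).le

theorem differentiableAt_integral_cpow_mul_exp {s r₀ : ℂ} (hs : 0 < s.re) (hr : 0 < r₀.re) :
    DifferentiableAt ℂ
      (fun r : ℂ => ∫ t : ℝ in Set.Ioi 0, (t : ℂ) ^ (s - 1) * Complex.exp (-(r * t))) r₀ := by
  have hmem : {r : ℂ | r₀.re / 2 < r.re} ∈ 𝓝 r₀ :=
    (isOpen_lt continuous_const Complex.continuous_re).mem_nhds (by simp; linarith)
  have hb : IntegrableOn (fun t : ℝ => t ^ s.re * Real.exp (-(r₀.re / 2 * t))) (Set.Ioi 0) :=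
    integrableOn_rpow_mul_exp_neg_mul (by linarith) (by linarith)
  refine (hasDerivAt_integral_of_dominated_loc_of_deriv_le hmem
    (F' := fun r t => (t : ℂ) ^ (s - 1) * (Complex.exp (-(r * t)) * -(t : ℂ)))
    (Eventually.of_forall fun r => aestronglyMeasurable_cpow_mul_exp s r)
    (integrableOn_cpow_mul_exp_neg_mul hs hr) ?_ ?_ hb ?_).2.differentiableAt
  · simp_rw [← mul_assoc]
    exact (aestronglyMeasurable_cpow_mul_exp s r₀).mul
      (Complex.continuous_ofReal.neg.aestronglyMeasurable)
  · filter_upwards [ae_restrict_mem measurableSet_Ioi] with t ht r hr'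
    have ht : 0 < t := ht
    have hr' : r₀.re / 2 < r.re := hr'
    rw [← mul_assoc, norm_mul, norm_cpow_mul_exp_neg_mul ht, norm_neg, Complex.norm_real,
      Real.norm_of_nonneg ht.le, mul_right_comm, ← Real.rpow_add_one ht.ne', sub_add_cancel]
    gcongr
  · filter_upwards with t r _
    have h1 : HasDerivAt (fun r : ℂ => -(r * (t : ℂ))) (-(t : ℂ)) r := by
      simpa using! ((hasDerivAt_id r).mul_const (t : ℂ)).neg
    exact h1.cexp.const_mul _

/-- Both sides are holomorphic in `r` on the right half-plane and agree for real `r`; the identity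
theorem does the rest. -/
theorem integral_cpow_mul_exp_neg_mul_complex {s r : ℂ} (hs : 0 < s.re) (hr : 0 < r.re) :
    ∫ t : ℝ in Set.Ioi 0, (t : ℂ) ^ (s - 1) * Complex.exp (-(r * t)) =
      r ^ (-s) * Complex.Gamma s := by
  have hU : IsOpen {r : ℂ | 0 < r.re} := isOpen_lt continuous_const Complex.continuous_re
  have hconn : IsPreconnected {r : ℂ | 0 < r.re} := (convex_halfSpace_re_gt 0).isPreconnected
  refine AnalyticOnNhd.eqOn_of_preconnected_of_frequently_eq (z₀ := 1)
    (f := fun r : ℂ => ∫ t : ℝ in Set.Ioi 0, (t : ℂ) ^ (s - 1) * Complex.exp (-(r * t)))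
    (g := fun r : ℂ => r ^ (-s) * Complex.Gamma s)
    (DifferentiableOn.analyticOnNhd (fun r hr =>
      (differentiableAt_integral_cpow_mul_exp hs hr).differentiableWithinAt) hU)
    (DifferentiableOn.analyticOnNhd (fun r hr => ?_) hU) hconn (show (0 : ℝ) < (1 : ℂ).re by simp) ?_ hr
  · have : r ∈ Complex.slitPlane := Or.inl hr
    exact (((differentiableAt_id).cpow_const this).mul_const _).differentiableWithinAt
  -- The reals `x > 1` accumulate at `1`.
  · have ht : Tendsto (fun x : ℝ => (x : ℂ)) (𝓝[>] 1) (𝓝[≠] 1) := by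
      refine tendsto_nhdsWithin_iff.2 ⟨?_, ?_⟩
      · exact (Complex.continuous_ofReal.tendsto' 1 1 (by simp)).mono_left nhdsWithin_le_nhds
      · filter_upwards [self_mem_nhdsWithin] with x hx
        have : (1 : ℝ) < x := hx
        simpa using this.ne'
    refine ht.frequently (Eventually.frequently ?_)
    filter_upwards [self_mem_nhdsWithin] with x hx
    have hx : 0 < x := lt_trans one_pos hx
    rw [Complex.integral_cpow_mul_exp_neg_mul_Ioi hs hx, one_div, Complex.inv_cpow,
      Complex.cpow_neg]
    rw [Complex.arg_ofReal_of_nonneg hx.le]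
    exact Real.pi_pos.ne

/-- The bound depends on `s` only through `Re s`, hence is uniform on vertical lines. -/
theorem norm_cpow_mul_Gamma_le {s r : ℂ} (hs : 0 < s.re) (hr : 0 < r.re) :
    ‖r ^ (-s) * Complex.Gamma s‖ ≤
      ∫ t : ℝ in Set.Ioi 0, t ^ (s.re - 1) * Real.exp (-(r.re * t)) := by
  rw [← integral_cpow_mul_exp_neg_mul_complex hs hr]
  refine (norm_integral_le_integral_norm _).trans_eq ?_
  exact setIntegral_congr_fun measurableSet_Ioi fun t ht => norm_cpow_mul_exp_neg_mul ht

/-! ### Decay of the Gamma function on vertical lines -/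

theorem norm_cpow_neg_vertical {r : ℂ} (hr : r ≠ 0) (γ y : ℝ) :
    ‖r ^ (-((γ : ℂ) + (y : ℂ) * Complex.I))‖ = ‖r‖ ^ (-γ) * Real.exp (r.arg * y) := by
  rw [Complex.norm_cpow_of_ne_zero hr, div_eq_mul_inv, ← Real.exp_neg]
  simp

/-- `Γ` decays like `exp (-φ |y|)` on vertical lines, for every `φ < π / 2`. -/
theorem exists_norm_Gamma_vertical_le {γ φ : ℝ} (hγ : 0 < γ) (h0 : 0 ≤ φ) (h1 : φ < Real.pi / 2) :
    ∃ C : ℝ, ∀ y : ℝ, ‖Complex.Gamma ((γ : ℂ) + (y : ℂ) * Complex.I)‖ ≤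
      C * Real.exp (-(φ * |y|)) := by
  refine ⟨∫ t : ℝ in Set.Ioi 0, t ^ (γ - 1) * Real.exp (-(Real.cos φ * t)), fun y => ?_⟩
  -- Rotate the ray of integration: for `r = e^{iθ}` the factor `|r^{-s}|` is `e^{θ y}`. Taking `θ =
  -- ±φ` with the sign of `y` gives the decay.
  have key : ∀ θ : ℝ, |θ| = φ → ‖Complex.Gamma ((γ : ℂ) + (y : ℂ) * Complex.I)‖ *
      Real.exp (θ * y) ≤ ∫ t : ℝ in Set.Ioi 0, t ^ (γ - 1) * Real.exp (-(Real.cos φ * t)) := by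
    intro θ hθ
    have hθ' := abs_le.1 hθ.le
    have hcos : Real.cos θ = Real.cos φ := by rw [← hθ, Real.cos_abs]
    have hcp : 0 < Real.cos φ := Real.cos_pos_of_mem_Ioo ⟨by linarith, h1⟩
    have hre : (Complex.exp (θ * Complex.I)).re = Real.cos φ := by
      rw [Complex.exp_ofReal_mul_I_re, hcos]
    have harg : (Complex.exp (θ * Complex.I)).arg = θ := by
      rw [Complex.exp_mul_I, Complex.arg_cos_add_sin_mul_I]
      constructor <;> linarith [Real.pi_pos]
    have := norm_cpow_mul_Gamma_le (s := (γ : ℂ) + (y : ℂ) * Complex.I)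
      (r := Complex.exp (θ * Complex.I)) (by simpa using hγ) (by rw [hre]; exact hcp)
    rw [norm_mul, norm_cpow_neg_vertical (Complex.exp_ne_zero _), harg, hre,
      Complex.norm_exp_ofReal_mul_I, Real.one_rpow, one_mul, mul_comm] at this
    simpa using this
  rw [Real.exp_neg, ← div_eq_mul_inv, le_div_iff₀ (Real.exp_pos _)]
  rcases le_total 0 y with hy | hy
  · rw [abs_of_nonneg hy]
    exact key φ (abs_of_nonneg h0)
  · rw [abs_of_nonpos hy, mul_neg, ← neg_mul]
    exact key (-φ) (by rw [abs_neg, abs_of_nonneg h0])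

theorem integrable_exp_neg_mul_abs {a : ℝ} (ha : 0 < a) :
    Integrable fun y : ℝ => Real.exp (-(a * |y|)) := by
  refine Integrable.of_integral_ne_zero ?_
  rw [integral_comp_abs (f := fun y => Real.exp (-(a * y)))]
  simp_rw [← neg_mul]
  rw [integral_exp_mul_Ioi (neg_neg_of_pos ha)]
  simp [ha.ne']

theorem continuous_Gamma_vertical {γ : ℝ} (hγ : 0 < γ) :
    Continuous fun y : ℝ => Complex.Gamma ((γ : ℂ) + (y : ℂ) * Complex.I) := by
  refine continuous_iff_continuousAt.2 fun y => ?_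
  refine ContinuousAt.comp (f := fun y : ℝ => (γ : ℂ) + (y : ℂ) * Complex.I)
    (Complex.differentiableAt_Gamma _ fun m h => ?_).continuousAt (by fun_prop)
  have := congrArg Complex.re h
  simp at this
  linarith [(Nat.cast_nonneg m : (0 : ℝ) ≤ m)]

theorem continuous_cpow_neg_vertical {r : ℂ} (hr : r ≠ 0) (γ : ℝ) :
    Continuous fun y : ℝ => r ^ (-((γ : ℂ) + (y : ℂ) * Complex.I)) :=
  Continuous.const_cpow (by fun_prop) (Or.inl hr)

/-- The power grows at most like `e^{|arg r| |y|}`, and `|arg r| < π/2` leaves room for a faster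
decay rate of `Γ`. -/
theorem integrable_Gamma_mul_cpow_vertical {γ : ℝ} (hγ : 0 < γ) {r : ℂ} (hr : 0 < r.re) :
    Integrable fun y : ℝ => Complex.Gamma ((γ : ℂ) + (y : ℂ) * Complex.I) *
      r ^ (-((γ : ℂ) + (y : ℂ) * Complex.I)) := by
  have hr0 : r ≠ 0 := by rintro rfl; simp at hr
  have harg : |r.arg| < Real.pi / 2 := Complex.abs_arg_lt_pi_div_two_iff.2 (Or.inl hr)
  obtain ⟨φ, h1, h2⟩ := exists_between harg
  obtain ⟨C, hC⟩ := exists_norm_Gamma_vertical_le hγ ((abs_nonneg _).trans h1.le) h2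
  refine ((integrable_exp_neg_mul_abs (sub_pos.2 h1)).const_mul (C * ‖r‖ ^ (-γ))).mono'
    ((continuous_Gamma_vertical hγ).mul
      (continuous_cpow_neg_vertical hr0 γ)).aestronglyMeasurable
    (Eventually.of_forall fun y => ?_)
  rw [norm_mul, norm_cpow_neg_vertical hr0]
  have h3 : Real.exp (r.arg * y) ≤ Real.exp (|r.arg| * |y|) :=
    Real.exp_le_exp.2 ((le_abs_self _).trans_eq (abs_mul _ _))
  have h4 : Real.exp (-((φ - |r.arg|) * |y|)) =
      Real.exp (-(φ * |y|)) * Real.exp (|r.arg| * |y|) := by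
    rw [← Real.exp_add]; congr 1; ring
  rw [h4]
  calc _ ≤ (C * Real.exp (-(φ * |y|))) * (‖r‖ ^ (-γ) * Real.exp (|r.arg| * |y|)) := by
        gcongr
        · exact (norm_nonneg _).trans (hC y)
        · exact hC y
    _ = _ := by ring

/-- The Cahen-Mellin integral. -/
theorem exp_neg_eq_integral_Gamma {γ : ℝ} (hγ : 0 < γ) {r : ℂ} (hr : 0 < r.re) :
    Complex.exp (-r) = (1 / (2 * (Real.pi : ℂ))) *
      ∫ y : ℝ, Complex.Gamma ((γ : ℂ) + (y : ℂ) * Complex.I) *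
        r ^ (-((γ : ℂ) + (y : ℂ) * Complex.I)) := by
  have hm : ∀ y : ℝ, mellin (fun t : ℝ => Complex.exp (-(r * t))) ((γ : ℂ) + (y : ℂ) * Complex.I) =
      Complex.Gamma ((γ : ℂ) + (y : ℂ) * Complex.I) *
        r ^ (-((γ : ℂ) + (y : ℂ) * Complex.I)) := fun y => by
    rw [mul_comm (Complex.Gamma _), ← integral_cpow_mul_exp_neg_mul_complex (by simpa using hγ) hr]
    rfl
  -- Mellin inversion of `t ↦ exp (-r t)`, evaluated at `t = 1`.
  have h := mellinInv_mellin_eq γ (fun t : ℝ => Complex.exp (-(r * t))) one_pos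
    (integrableOn_cpow_mul_exp_neg_mul (s := γ) (by simpa using hγ) hr)
    (by
      refine (integrable_Gamma_mul_cpow_vertical hγ hr).congr (Eventually.of_forall fun y => ?_)
      exact (hm y).symm)
    (by fun_prop)
  simp only [mellinInv, hm] at h
  simpa using h.symm

/-! ### Arguments of complex powers -/

/-- The quotient `Re z / |z|` is the cosine of `|arg z|`, and cosine is strictly decreasing on `[0,
π]`. -/
theorem abs_arg_le_of_re_div_norm_le {z w : ℂ} (hz : z ≠ 0) (hw : w ≠ 0)
    (h : w.re / ‖w‖ ≤ z.re / ‖z‖) : |z.arg| ≤ |w.arg| := by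
  by_contra hlt
  have h1 := Real.strictAntiOn_cos ⟨abs_nonneg _, Complex.abs_arg_le_pi w⟩
    ⟨abs_nonneg _, Complex.abs_arg_le_pi z⟩ (not_le.1 hlt)
  rw [Real.cos_abs, Real.cos_abs, Complex.cos_arg hz, Complex.cos_arg hw] at h1
  linarith

theorem re_div_norm_le_re_div_norm_add {p q : ℝ} (hp : 0 < p) (hq : 0 ≤ q) {ζ : ℂ}
    (hζ : 0 < ζ.re) : ζ.re / ‖ζ‖ ≤ ((p : ℂ) + q * ζ).re / ‖(p : ℂ) + q * ζ‖ := by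
  have hre : ((p : ℂ) + q * ζ).re = p + q * ζ.re := by simp
  have hpos : 0 < ((p : ℂ) + q * ζ).re := by rw [hre]; positivity
  have hn : 0 < ‖(p : ℂ) + q * ζ‖ := hpos.trans_le (Complex.re_le_norm _)
  have hζn : 0 < ‖ζ‖ := hζ.trans_le (Complex.re_le_norm _)
  have htri : ‖(p : ℂ) + q * ζ‖ ≤ p + q * ‖ζ‖ := by
    refine (norm_add_le _ _).trans_eq ?_
    rw [norm_mul, Complex.norm_real, Complex.norm_real, Real.norm_of_nonneg hp.le,
      Real.norm_of_nonneg hq]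
  rw [div_le_div_iff₀ hζn hn, hre]
  calc ζ.re * ‖(p : ℂ) + q * ζ‖ ≤ ζ.re * (p + q * ‖ζ‖) := by gcongr
    _ = p * ζ.re + q * ζ.re * ‖ζ‖ := by ring
    _ ≤ p * ‖ζ‖ + q * ζ.re * ‖ζ‖ := by gcongr; exact Complex.re_le_norm _
    _ = _ := by ring

theorem arg_cpow_ofReal {w : ℂ} (hw : w ≠ 0) {η : ℝ} (h : |η * w.arg| < Real.pi) :
    (w ^ (η : ℂ)).arg = η * w.arg := by
  have him : (Complex.log w * η).im = η * w.arg := by simp [Complex.log_im, mul_comm]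
  rw [Complex.cpow_def_of_ne_zero hw, ← Complex.log_im, Complex.log_exp, him]
  · rw [him]; exact (abs_lt.1 h).1
  · rw [him]; exact (abs_lt.1 h).2.le

theorem re_cpow_ofReal_pos {w : ℂ} (hw : 0 < w.re) {η : ℝ} (h0 : 0 ≤ η) (h1 : η ≤ 1) :
    0 < (w ^ (η : ℂ)).re := by
  have hw0 : w ≠ 0 := by rintro rfl; simp at hw
  have harg : |w.arg| < Real.pi / 2 := Complex.abs_arg_lt_pi_div_two_iff.2 (Or.inl hw)
  have h2 : |η * w.arg| < Real.pi / 2 := by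
    rw [abs_mul, abs_of_nonneg h0]
    exact (mul_le_of_le_one_left (abs_nonneg _) h1).trans_lt harg
  have h3 := arg_cpow_ofReal hw0 (h2.trans (by linarith [Real.pi_pos]))
  rw [← h3] at h2
  refine (Complex.abs_arg_lt_pi_div_two_iff.1 h2).resolve_right ?_
  simp [Complex.cpow_eq_zero_iff, hw0]

/-- The bound on the arguments keeps `log B - β log A` in the principal strip, so it is the
principal logarithm of `B A^{-β}`. -/
theorem mul_cpow_cpow_neg {A B : ℂ} (hA : A ≠ 0) (hB : B ≠ 0) {β : ℝ} (hβ : 0 ≤ β)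
    (h : |B.arg| + β * |A.arg| < Real.pi) (v : ℂ) :
    (B * A ^ ((-β : ℝ) : ℂ)) ^ (-v) = B ^ (-v) * A ^ ((β : ℂ) * v) := by
  have h1 : B * A ^ ((-β : ℝ) : ℂ) = Complex.exp (Complex.log B - β * Complex.log A) := by
    rw [Complex.cpow_def_of_ne_zero hA, sub_eq_add_neg, Complex.exp_add, Complex.exp_log hB]
    push_cast
    ring_nf
  have him : (Complex.log B - β * Complex.log A).im = B.arg - β * A.arg := by
    simp [Complex.log_im]
  have habs : |B.arg - β * A.arg| < Real.pi := by
    refine (abs_sub _ _).trans_lt ?_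
    rwa [abs_mul, abs_of_nonneg hβ]
  rw [h1, Complex.cpow_def_of_ne_zero (Complex.exp_ne_zero _), Complex.log_exp,
    Complex.cpow_def_of_ne_zero hA, Complex.cpow_def_of_ne_zero hB, ← Complex.exp_add]
  · ring_nf
  · rw [him]; exact (abs_lt.1 habs).1
  · rw [him]; exact (abs_lt.1 habs).2.le

theorem ofReal_mul_cpow {a : ℝ} (ha : 0 < a) {w : ℂ} (hw : w ≠ 0) (s : ℂ) :
    ((a : ℂ) * w) ^ s = (a : ℂ) ^ s * w ^ s := by
  have ha' : (a : ℂ) ≠ 0 := by exact_mod_cast ha.ne'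
  rw [Complex.cpow_def_of_ne_zero (mul_ne_zero ha' hw), Complex.cpow_def_of_ne_zero ha',
    Complex.cpow_def_of_ne_zero hw, ← Complex.exp_add, Complex.log_ofReal_mul ha hw,
    Complex.ofReal_log ha.le]
  ring_nf

/-! ### The Laplace integral `∫ exp (-B r ^ β - A r)` as a Mellin-Barnes integral -/

section MellinBarnes

variable {A B : ℂ} {β γ : ℝ}

theorem one_sub_mul_vertical_re (β γ y : ℝ) :
    (1 - (β : ℂ) * ((γ : ℂ) + (y : ℂ) * Complex.I)).re = 1 - β * γ := by
  simp

theorem continuous_Gamma_one_sub_vertical (hβγ : β * γ < 1) :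
    Continuous fun y : ℝ => Complex.Gamma (1 - (β : ℂ) * ((γ : ℂ) + (y : ℂ) * Complex.I)) := by
  have h := (continuous_Gamma_vertical (γ := 1 - β * γ) (by linarith)).comp
    (continuous_const_mul (-β))
  refine h.congr fun y => ?_
  simp only [Function.comp]
  congr 1
  push_cast
  ring

/-- The factor in `B` is already integrable; the one in `A` only has to be bounded along the line.
-/
theorem integrable_mellinBarnes (hA : 0 < A.re) (hB : 0 < B.re) (hγ : 0 < γ) (hβγ : β * γ < 1) :
    Integrable fun y : ℝ => (Complex.Gamma ((γ : ℂ) + (y : ℂ) * Complex.I) *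
      B ^ (-((γ : ℂ) + (y : ℂ) * Complex.I))) *
      (A ^ (-(1 - (β : ℂ) * ((γ : ℂ) + (y : ℂ) * Complex.I))) *
        Complex.Gamma (1 - (β : ℂ) * ((γ : ℂ) + (y : ℂ) * Complex.I))) := by
  have hA0 : A ≠ 0 := by rintro rfl; simp at hA
  refine (integrable_Gamma_mul_cpow_vertical hγ hB).mul_bdd
    (c := ∫ t : ℝ in Set.Ioi 0, t ^ (1 - β * γ - 1) * Real.exp (-(A.re * t))) ?_ ?_
  · exact ((Continuous.const_cpow (by fun_prop) (Or.inl hA0)).mul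
      (continuous_Gamma_one_sub_vertical hβγ)).aestronglyMeasurable
  · refine Eventually.of_forall fun y => ?_
    have := norm_cpow_mul_Gamma_le (r := A)
      (s := 1 - (β : ℂ) * ((γ : ℂ) + (y : ℂ) * Complex.I))
      (by rw [one_sub_mul_vertical_re]; linarith) hA
    rwa [one_sub_mul_vertical_re] at this

/-- On a vertical line `|r^{-βv}|` depends only on `Re v`, so the absolute value splits into a
function of `r` times a function of `y`. -/
theorem integrable_prod_mellinBarnes (hA : 0 < A.re) (hB : 0 < B.re) (hγ : 0 < γ)
    (hβγ : β * γ < 1) :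
    Integrable (Function.uncurry fun (r y : ℝ) =>
      (Complex.Gamma ((γ : ℂ) + (y : ℂ) * Complex.I) *
        B ^ (-((γ : ℂ) + (y : ℂ) * Complex.I))) *
      ((r : ℂ) ^ ((1 - (β : ℂ) * ((γ : ℂ) + (y : ℂ) * Complex.I)) - 1) *
        Complex.exp (-(A * r)))) ((volume.restrict (Set.Ioi 0)).prod volume) := by
  have hB0 : B ≠ 0 := by rintro rfl; simp at hB
  have h1 := integrableOn_rpow_mul_exp_neg_mul (a := 1 - β * γ - 1) (by linarith) hA
  have h2 := (integrable_Gamma_mul_cpow_vertical hγ hB).norm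
  have hmeas : (volume.restrict (Set.Ioi (0 : ℝ))).prod (volume : Measure ℝ) =
      (volume.prod volume).restrict (Set.Ioi 0 ×ˢ Set.univ) := by
    rw [← Measure.prod_restrict, Measure.restrict_univ]
  refine (Integrable.mul_prod (μ := volume.restrict (Set.Ioi 0)) (ν := volume) h1 h2).mono' ?_ ?_
  · rw [hmeas]
    refine ContinuousOn.aestronglyMeasurable (fun p hp => ?_)
      (measurableSet_Ioi.prod MeasurableSet.univ)
    have hp : (p.1 : ℂ) ∈ Complex.slitPlane := Complex.ofReal_mem_slitPlane.2 hp.1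
    refine ContinuousAt.continuousWithinAt (ContinuousAt.mul ?_ (ContinuousAt.mul ?_ ?_))
    · exact (((continuous_Gamma_vertical hγ).mul (continuous_cpow_neg_vertical hB0 γ)).comp
        continuous_snd).continuousAt
    · exact ContinuousAt.cpow (by fun_prop) (by fun_prop) hp
    · fun_prop
  · rw [hmeas]
    filter_upwards [ae_restrict_mem (measurableSet_Ioi.prod MeasurableSet.univ)] with p hp
    rw [Function.uncurry, norm_mul, norm_cpow_mul_exp_neg_mul hp.1, one_sub_mul_vertical_re,
      mul_comm]

theorem integral_exp_eq_mellinBarnes (hA : 0 < A.re) (hB : 0 < B.re) (hγ : 0 < γ)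
    (hβγ : β * γ < 1) :
    ∫ r : ℝ in Set.Ioi 0, Complex.exp (-(B * (r ^ β : ℝ)) - A * r) =
      (1 / (2 * (Real.pi : ℂ))) * ∫ y : ℝ,
        (Complex.Gamma ((γ : ℂ) + (y : ℂ) * Complex.I) *
          B ^ (-((γ : ℂ) + (y : ℂ) * Complex.I))) *
        (A ^ (-(1 - (β : ℂ) * ((γ : ℂ) + (y : ℂ) * Complex.I))) *
          Complex.Gamma (1 - (β : ℂ) * ((γ : ℂ) + (y : ℂ) * Complex.I))) := by
  have hB0 : B ≠ 0 := by rintro rfl; simp at hB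
  have hsw := integral_integral_swap (integrable_prod_mellinBarnes hA hB hγ hβγ)
  have hright : ∀ y : ℝ, ∫ r : ℝ in Set.Ioi 0,
      (Complex.Gamma ((γ : ℂ) + (y : ℂ) * Complex.I) *
        B ^ (-((γ : ℂ) + (y : ℂ) * Complex.I))) *
      ((r : ℂ) ^ ((1 - (β : ℂ) * ((γ : ℂ) + (y : ℂ) * Complex.I)) - 1) *
        Complex.exp (-(A * r))) =
      (Complex.Gamma ((γ : ℂ) + (y : ℂ) * Complex.I) *
          B ^ (-((γ : ℂ) + (y : ℂ) * Complex.I))) *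
        (A ^ (-(1 - (β : ℂ) * ((γ : ℂ) + (y : ℂ) * Complex.I))) *
          Complex.Gamma (1 - (β : ℂ) * ((γ : ℂ) + (y : ℂ) * Complex.I))) := fun y => by
    rw [integral_const_mul, integral_cpow_mul_exp_neg_mul_complex
      (by rw [one_sub_mul_vertical_re]; linarith) hA]
  simp_rw [hright] at hsw
  rw [← hsw, ← integral_const_mul]
  refine setIntegral_congr_fun measurableSet_Ioi fun r hr => ?_
  have hr : 0 < r := hr
  have hrβ : 0 < r ^ β := Real.rpow_pos_of_pos hr β
  have hre : 0 < (((r ^ β : ℝ) : ℂ) * B).re := by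
    rw [Complex.re_ofReal_mul]; positivity
  rw [sub_eq_add_neg, Complex.exp_add, mul_comm B, exp_neg_eq_integral_Gamma hγ hre, mul_assoc,
    ← integral_mul_const]
  congr 1
  refine integral_congr_ae (Eventually.of_forall fun y => ?_)
  simp only
  rw [ofReal_mul_cpow hrβ hB0]
  -- The exponent `-βv` is written as `(1 - βv) - 1` to match the Gamma integral at `1 - βv`.
  have hpow : ((r ^ β : ℝ) : ℂ) ^ (-((γ : ℂ) + (y : ℂ) * Complex.I)) =
      (r : ℂ) ^ ((1 - (β : ℂ) * ((γ : ℂ) + (y : ℂ) * Complex.I)) - 1) := by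
    have hr' : (r : ℂ) ≠ 0 := by exact_mod_cast hr.ne'
    rw [Complex.cpow_def_of_ne_zero (by exact_mod_cast hrβ.ne'), Complex.cpow_def_of_ne_zero hr',
      ← Complex.ofReal_log hrβ.le, ← Complex.ofReal_log hr.le, Real.log_rpow hr]
    push_cast
    ring_nf
  rw [hpow]
  ring

end MellinBarnes

/-! ### The Fox H-function `H^{1,1}_{1,1}` -/

theorem foxSeparates_iff {α γ : ℝ} (hα : 0 < α) :
    FoxSeparates 1 1 ![((0 : ℂ), α / 2)] ![((0 : ℂ), (1 : ℝ))] γ ↔ 0 < γ ∧ α / 2 * γ < 1 := by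
  have hre : ∀ ν : ℕ, ((1 - 0 + (ν : ℂ)) / ((α / 2 : ℝ) : ℂ)).re = (1 + ν) / (α / 2) := fun ν => by
    rw [Complex.div_ofReal_re]; simp
  have hpos : 0 < α / 2 := by positivity
  constructor
  · rintro ⟨h1, h2⟩
    have h1 := h1 0 (by simp) 0
    have h2 := h2 0 (by simp) 0
    simp only [Matrix.cons_val_zero] at h1 h2
    rw [hre, lt_div_iff₀ hpos] at h2
    refine ⟨by simpa using h1, ?_⟩
    rw [mul_comm]
    simpa using h2
  · rintro ⟨h1, h2⟩
    refine ⟨fun j _ ν => ?_, fun j _ ν => ?_⟩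
    · have hj : j = 0 := Subsingleton.elim _ _
      subst hj
      have : (0 : ℝ) ≤ ν := Nat.cast_nonneg ν
      simp
      linarith
    · have hj : j = 0 := Subsingleton.elim _ _
      subst hj
      have : (0 : ℝ) ≤ ν := Nat.cast_nonneg ν
      simp only [Matrix.cons_val_zero]
      rw [hre, lt_div_iff₀ hpos, mul_comm]
      linarith

/-- The outer factor `A` comes from `A^{βv} = A · A^{-(1 - βv)}` with `β = α/2`. -/
theorem foxIntegrand_eq {A B : ℂ} (hA : A ≠ 0) (hB : B ≠ 0) {α : ℝ} (hα : 0 ≤ α)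
    (h : |B.arg| + α / 2 * |A.arg| < Real.pi) (γ y : ℝ) :
    foxIntegrand 1 1 ![((0 : ℂ), α / 2)] ![((0 : ℂ), (1 : ℝ))] γ
        (B * A ^ ((-(α / 2) : ℝ) : ℂ)) y =
      A * ((Complex.Gamma ((γ : ℂ) + (y : ℂ) * Complex.I) *
          B ^ (-((γ : ℂ) + (y : ℂ) * Complex.I))) *
        (A ^ (-(1 - ((α / 2 : ℝ) : ℂ) * ((γ : ℂ) + (y : ℂ) * Complex.I))) *
          Complex.Gamma (1 - ((α / 2 : ℝ) : ℂ) * ((γ : ℂ) + (y : ℂ) * Complex.I)))) := by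
  rw [foxIntegrand, mul_cpow_cpow_neg hA hB (by positivity) h, neg_sub,
    Complex.cpow_sub _ _ hA, Complex.cpow_one]
  simp only [foxKernel, Finset.univ_unique, Fin.default_eq_zero, Finset.prod_singleton,
    Fin.val_zero, zero_lt_one, if_true, Matrix.cons_val_zero, Complex.ofReal_one, one_mul,
    zero_add, sub_zero, Fin.isValue]
  field_simp

theorem integrable_foxIntegrand {A B : ℂ} (hA : 0 < A.re) (hB : 0 < B.re) {α γ : ℝ} (hα : 0 < α)
    (h : |B.arg| + α / 2 * |A.arg| < Real.pi)
    (hγ : FoxSeparates 1 1 ![((0 : ℂ), α / 2)] ![((0 : ℂ), (1 : ℝ))] γ) :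
    Integrable (foxIntegrand 1 1 ![((0 : ℂ), α / 2)] ![((0 : ℂ), (1 : ℝ))] γ
      (B * A ^ ((-(α / 2) : ℝ) : ℂ))) := by
  have hA0 : A ≠ 0 := by rintro rfl; simp at hA
  have hB0 : B ≠ 0 := by rintro rfl; simp at hB
  obtain ⟨h1, h2⟩ := (foxSeparates_iff hα).1 hγ
  refine ((integrable_mellinBarnes hA hB h1 h2).const_mul A).congr
    (Eventually.of_forall fun y => ?_)
  exact (foxIntegrand_eq hA0 hB0 hα.le h γ y).symm

/-- The right-hand side does not involve `γ`, so all separating lines give the same value without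
any contour shift. -/
theorem foxLine_eq {A B : ℂ} (hA : 0 < A.re) (hB : 0 < B.re) {α γ : ℝ} (hα : 0 < α)
    (h : |B.arg| + α / 2 * |A.arg| < Real.pi)
    (hγ : FoxSeparates 1 1 ![((0 : ℂ), α / 2)] ![((0 : ℂ), (1 : ℝ))] γ) :
    foxLine 1 1 ![((0 : ℂ), α / 2)] ![((0 : ℂ), (1 : ℝ))] γ (B * A ^ ((-(α / 2) : ℝ) : ℂ)) =
      A * ∫ r : ℝ in Set.Ioi 0, Complex.exp (-(B * (r ^ (α / 2) : ℝ)) - A * r) := by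
  have hA0 : A ≠ 0 := by rintro rfl; simp at hA
  have hB0 : B ≠ 0 := by rintro rfl; simp at hB
  obtain ⟨h1, h2⟩ := (foxSeparates_iff hα).1 hγ
  rw [integral_exp_eq_mellinBarnes hA hB h1 h2, foxLine]
  simp_rw [foxIntegrand_eq hA0 hB0 hα.le h γ]
  rw [integral_const_mul]
  ring

theorem exists_foxSeparates {α : ℝ} (hα : 0 < α) :
    ∃ γ : ℝ, FoxSeparates 1 1 ![((0 : ℂ), α / 2)] ![((0 : ℂ), (1 : ℝ))] γ := by
  -- The midpoint of the admissible strip `0 < γ < 2/α`.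
  refine ⟨1 / α, (foxSeparates_iff hα).2 ⟨by positivity, ?_⟩⟩
  field_simp
  norm_num

theorem foxH_eq {A B : ℂ} (hA : 0 < A.re) (hB : 0 < B.re) {α : ℝ} (hα : 0 < α)
    (h : |B.arg| + α / 2 * |A.arg| < Real.pi) :
    foxH 1 1 ![((0 : ℂ), α / 2)] ![((0 : ℂ), (1 : ℝ))] (B * A ^ ((-(α / 2) : ℝ) : ℂ)) =
      A * ∫ r : ℝ in Set.Ioi 0, Complex.exp (-(B * (r ^ (α / 2) : ℝ)) - A * r) := by
  have hex := exists_foxSeparates hα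
  rw [foxH, dif_pos hex]
  exact foxLine_eq hA hB hα h hex.choose_spec

/-! ### The Rayleigh law -/

theorem measurable_fd (c lam : ℝ) : Measurable (fd c lam) :=
  Measurable.ite measurableSet_Ici (by fun_prop) measurable_const

theorem fd_of_nonneg {c lam x : ℝ} (hx : 0 ≤ x) :
    fd c lam x = 2 * c * lam * Real.pi * x * Real.exp (-(c * lam * Real.pi * x ^ 2)) :=
  if_pos hx

theorem fd_of_nonpos {c lam x : ℝ} (hx : x ≤ 0) : fd c lam x = 0 := by
  rcases hx.eq_or_lt with rfl | h
  · simp [fd]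
  · exact if_neg (not_le.2 h)

theorem fd_nonneg {c lam : ℝ} (hc : 0 < c) (hlam : 0 < lam) (x : ℝ) : 0 ≤ fd c lam x := by
  rcases le_total x 0 with h | h
  · exact (fd_of_nonpos h).ge
  · rw [fd_of_nonneg h]; positivity

theorem distLaw_Iic_zero (c lam : ℝ) : distLaw c lam (Set.Iic 0) = 0 := by
  rw [distLaw, withDensity_apply _ measurableSet_Iic,
    setLIntegral_congr_fun (g := fun _ => 0) measurableSet_Iic fun x hx => by
      simp [fd_of_nonpos (c := c) (lam := lam) (show x ≤ 0 from hx)]]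
  simp

theorem distLaw_Ioi_of_nonneg {c lam : ℝ} (hc : 0 < c) (hlam : 0 < lam) {x : ℝ} (hx : 0 ≤ x) :
    distLaw c lam (Set.Ioi x) = ENNReal.ofReal (Real.exp (-(c * lam * Real.pi * x ^ 2))) := by
  have hder : ∀ t ∈ Set.Ici x,
      HasDerivAt (fun t => -Real.exp (-(c * lam * Real.pi * t ^ 2))) (fd c lam t) t := by
    intro t ht
    have h1 : HasDerivAt (fun t : ℝ => -(c * lam * Real.pi * t ^ 2))
        (-(c * lam * Real.pi * (2 * t))) t := by
      simpa using! ((hasDerivAt_pow 2 t).const_mul (c * lam * Real.pi)).neg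
    have h2 := h1.exp.neg
    rw [fd_of_nonneg (hx.trans ht)]
    refine h2.congr_deriv ?_
    ring
  have hlim : Tendsto (fun t => -Real.exp (-(c * lam * Real.pi * t ^ 2))) atTop (𝓝 (-0)) := by
    refine (Real.tendsto_exp_neg_atTop_nhds_zero.comp ?_).neg
    exact (tendsto_pow_atTop two_ne_zero).const_mul_atTop (by positivity)
  have hpos : ∀ t ∈ Set.Ioi x, 0 ≤ fd c lam t := fun t _ => fd_nonneg hc hlam t
  rw [distLaw, withDensity_apply _ measurableSet_Ioi, ← ofReal_integral_eq_lintegral_ofReal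
    (integrableOn_Ioi_deriv_of_nonneg' hder hpos hlim) (ae_of_all _ (fd_nonneg hc hlam)),
    integral_Ioi_of_hasDerivAt_of_nonneg' hder hpos hlim]
  simp

theorem distLaw_Ioi {c lam : ℝ} (hc : 0 < c) (hlam : 0 < lam) (x : ℝ) :
    distLaw c lam (Set.Ioi x) =
      ENNReal.ofReal (Real.exp (-(c * lam * Real.pi * (max x 0) ^ 2))) := by
  rw [← distLaw_Ioi_of_nonneg hc hlam (le_max_right x 0)]
  refine le_antisymm ?_ (measure_mono (Set.Ioi_subset_Ioi (le_max_left x 0)))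
  calc distLaw c lam (Set.Ioi x) ≤ distLaw c lam (Set.Ioi (max x 0) ∪ Set.Iic 0) := by
        refine measure_mono fun t ht => ?_
        rcases lt_or_ge 0 t with h | h
        · exact Or.inl (max_lt ht h)
        · exact Or.inr h
    _ ≤ distLaw c lam (Set.Ioi (max x 0)) + distLaw c lam (Set.Iic 0) := measure_union_le _ _
    _ = _ := by rw [distLaw_Iic_zero, add_zero]

theorem isProbabilityMeasure_distLaw {c lam : ℝ} (hc : 0 < c) (hlam : 0 < lam) :
    IsProbabilityMeasure (distLaw c lam) := by
  constructor
  rw [← Set.Iic_union_Ioi (a := (0 : ℝ)), measure_union (Set.Iic_disjoint_Ioi le_rfl)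
    measurableSet_Ioi, distLaw_Iic_zero, distLaw_Ioi hc hlam]
  simp

theorem one_sub_Fd {c lam : ℝ} (hc : 0 < c) (hlam : 0 < lam) {x : ℝ} (hx : 0 ≤ x) :
    1 - Fd c lam x = Real.exp (-(c * lam * Real.pi * x ^ 2)) := by
  have := isProbabilityMeasure_distLaw hc hlam
  rw [Fd, ← probReal_compl_eq_one_sub measurableSet_Iic, Set.compl_Iic, measureReal_def,
    distLaw_Ioi_of_nonneg hc hlam hx, ENNReal.toReal_ofReal (Real.exp_pos _).le]

theorem two_mul_one_sub_Fd_mul_fd {c lam : ℝ} (hc : 0 < c) (hlam : 0 < lam) (x : ℝ) :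
    2 * (1 - Fd c lam x) * fd c lam x = fd (2 * c) lam x := by
  rcases le_total x 0 with hx | hx
  · rw [fd_of_nonpos hx, fd_of_nonpos hx, mul_zero]
  · rw [one_sub_Fd hc hlam hx, fd_of_nonneg hx, fd_of_nonneg hx,
      show -(2 * c * lam * Real.pi * x ^ 2) =
        -(c * lam * Real.pi * x ^ 2) + -(c * lam * Real.pi * x ^ 2) by ring, Real.exp_add]
    ring

/-! ### The distance of the near user -/

section NearUser

variable {Ω : Type*} [MeasurableSpace Ω] {μ : Measure Ω} {K : ℕ} {c lam : ℝ}
  {D : Fin (2 * K) → Ω → ℝ} {g : Ω → Grouping K}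

theorem measurable_nearDist (hgroup : IsRandomGrouping μ K c lam D g) (k : Fin K) :
    Measurable (nearDist D g k) := by
  intro s hs
  have : nearDist D g k ⁻¹' s = ⋃ e : Grouping K, g ⁻¹' {e} ∩
      (fun ω => min (D (e (k, 0)) ω) (D (e (k, 1)) ω)) ⁻¹' s := by
    ext ω
    simp [nearDist]
  rw [this]
  exact MeasurableSet.iUnion fun e => (hgroup.measurable_grouping trivial).inter
    (((hgroup.measurable_dist _).min (hgroup.measurable_dist _)) hs)

/-- On the event `g = e` the pair consists of two fixed, distinct users, whose distances are
independent of each other and jointly independent of `g`. -/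
theorem measure_grouping_inter (hgroup : IsRandomGrouping μ K c lam D g) (k : Fin K)
    (e : Grouping K) (x : ℝ) :
    μ (g ⁻¹' {e} ∩ nearDist D g k ⁻¹' Set.Ioi x) =
      μ (g ⁻¹' {e}) * distLaw c lam (Set.Ioi x) ^ 2 := by
  have hT : MeasurableSet {d : Fin (2 * K) → ℝ | x < d (e (k, 0)) ∧ x < d (e (k, 1))} :=
    (measurableSet_lt measurable_const (measurable_pi_apply _)).inter
      (measurableSet_lt measurable_const (measurable_pi_apply _))
  have h1 : g ⁻¹' {e} ∩ nearDist D g k ⁻¹' Set.Ioi x = g ⁻¹' {e} ∩ (fun ω i => D i ω) ⁻¹'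
      {d : Fin (2 * K) → ℝ | x < d (e (k, 0)) ∧ x < d (e (k, 1))} := by
    ext ω
    simp only [Set.mem_inter_iff, Set.mem_preimage, Set.mem_singleton_iff, Set.mem_Ioi,
      Set.mem_ofPred_eq, nearDist, lt_min_iff]
    refine and_congr_right fun h => ?_
    rw [h]
  have hne : e (k, 0) ≠ e (k, 1) := fun h => by simpa using e.injective h
  have h2 : (fun ω i => D i ω) ⁻¹' {d : Fin (2 * K) → ℝ | x < d (e (k, 0)) ∧ x < d (e (k, 1))} =
      D (e (k, 0)) ⁻¹' Set.Ioi x ∩ D (e (k, 1)) ⁻¹' Set.Ioi x := rfl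
  have h3 : ∀ i, μ (D i ⁻¹' Set.Ioi x) = distLaw c lam (Set.Ioi x) := fun i => by
    rw [← hgroup.law_dist i, Measure.map_apply (hgroup.measurable_dist i) measurableSet_Ioi]
  rw [h1, hgroup.indep_grouping.measure_inter_preimage_eq_mul _ _ trivial hT, h2,
    (hgroup.indep_dist.indepFun hne).measure_inter_preimage_eq_mul _ _ measurableSet_Ioi
      measurableSet_Ioi, h3, h3, sq]

theorem measure_nearDist_Ioi [IsProbabilityMeasure μ] (hgroup : IsRandomGrouping μ K c lam D g)
    (k : Fin K) (x : ℝ) :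
    μ (nearDist D g k ⁻¹' Set.Ioi x) = distLaw c lam (Set.Ioi x) ^ 2 := by
  have hmeas : ∀ e, MeasurableSet (g ⁻¹' {e}) := fun e => hgroup.measurable_grouping trivial
  have hdisj : Pairwise (Function.onFun Disjoint fun e : Grouping K => g ⁻¹' {e}) :=
    fun e e' h => Disjoint.preimage g (by simpa using h)
  have hcov : ⋃ e : Grouping K, g ⁻¹' {e} = Set.univ := by
    ext ω
    simp
  have hsum : ∑ e : Grouping K, μ (g ⁻¹' {e}) = 1 := by
    rw [← tsum_fintype (L := .unconditional _), ← measure_iUnion hdisj hmeas, hcov,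
      measure_univ]
  have hdec : nearDist D g k ⁻¹' Set.Ioi x =
      ⋃ e : Grouping K, g ⁻¹' {e} ∩ nearDist D g k ⁻¹' Set.Ioi x := by
    rw [← Set.iUnion_inter, hcov, Set.univ_inter]
  rw [hdec, measure_iUnion (fun e e' h => (hdisj h).mono Set.inter_subset_left
      Set.inter_subset_left)
    (fun e => (hmeas e).inter (measurable_nearDist hgroup k measurableSet_Ioi)), tsum_fintype]
  simp_rw [measure_grouping_inter hgroup]
  rw [← Finset.sum_mul, hsum, one_mul]

/-- The distance of the near user is again Rayleigh distributed, with twice the rate. -/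
theorem map_nearDist [IsProbabilityMeasure μ] (hc : 0 < c) (hlam : 0 < lam)
    (hgroup : IsRandomGrouping μ K c lam D g) (k : Fin K) :
    μ.map (nearDist D g k) = distLaw (2 * c) lam := by
  have := isProbabilityMeasure_distLaw (c := 2 * c) (by positivity) hlam
  have hm := measurable_nearDist hgroup k
  have := Measure.isProbabilityMeasure_map hm.aemeasurable (μ := μ)
  -- Comparing distribution functions suffices, and squaring the tail doubles its exponent.
  refine Measure.ext_of_Iic _ _ fun x => ?_
  rw [← Set.compl_Ioi, prob_compl_eq_one_sub measurableSet_Ioi,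
    prob_compl_eq_one_sub measurableSet_Ioi, Measure.map_apply hm measurableSet_Ioi,
    measure_nearDist_Ioi hgroup, distLaw_Ioi hc hlam, distLaw_Ioi (by positivity) hlam,
    ← ENNReal.ofReal_pow (Real.exp_pos _).le, ← Real.exp_nat_mul]
  congr 4
  push_cast
  ring

end NearUser

/-! ### Small perturbations of the exponential integral -/

/-- Mean value inequality on the convex set `Re z ≥ 0`, where the derivative has norm at most `1`.
-/
theorem norm_exp_neg_sub_one_le {z : ℂ} (hz : 0 ≤ z.re) : ‖Complex.exp (-z) - 1‖ ≤ ‖z‖ := by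
  have hder : ∀ x ∈ {x : ℂ | 0 ≤ x.re},
      HasDerivWithinAt (fun x : ℂ => Complex.exp (-x)) (-Complex.exp (-x)) {x : ℂ | 0 ≤ x.re} x := by
    intro x _
    simpa using! (hasDerivAt_id x).neg.cexp.hasDerivWithinAt
  have := (convex_halfSpace_re_ge 0).norm_image_sub_le_of_norm_hasDerivWithin_le (C := 1) hder
    (fun x hx => by
      have hx : 0 ≤ x.re := hx
      rw [norm_neg, Complex.norm_exp, Real.exp_le_one_iff]
      simpa using hx) (show (0 : ℝ) ≤ (0 : ℂ).re by simp) hz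
  simpa using this

theorem integrableOn_exp_neg_mul {A : ℂ} (hA : 0 < A.re) :
    IntegrableOn (fun r : ℝ => Complex.exp (-(A * r))) (Set.Ioi 0) := by
  simpa using integrableOn_cpow_mul_exp_neg_mul (s := 1) (by simp) hA

theorem mul_integral_exp_neg_mul {A : ℂ} (hA : 0 < A.re) :
    A * ∫ r : ℝ in Set.Ioi 0, Complex.exp (-(A * r)) = 1 := by
  have hA0 : A ≠ 0 := by rintro rfl; simp at hA
  have h := integral_cpow_mul_exp_neg_mul_complex (s := 1) (by simp) hA
  simp only [sub_self, Complex.cpow_zero, one_mul, Complex.cpow_neg_one, Complex.Gamma_one,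
    mul_one] at h
  rw [h, mul_inv_cancel₀ hA0]

theorem integrableOn_exp_sub {A B : ℂ} (hA : 0 < A.re) (hB : 0 ≤ B.re) (β : ℝ) :
    IntegrableOn (fun r : ℝ => Complex.exp (-(B * (r ^ β : ℝ)) - A * r)) (Set.Ioi 0) := by
  refine Integrable.mono (integrableOn_exp_neg_mul hA) ?_ ?_
  · have : Measurable fun r : ℝ => Complex.exp (-(B * (r ^ β : ℝ)) - A * r) := by fun_prop
    exact this.aestronglyMeasurable
  filter_upwards [ae_restrict_mem measurableSet_Ioi] with r hr
  have hr : 0 < r := hr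
  have hrβ : 0 < r ^ β := Real.rpow_pos_of_pos hr β
  rw [Complex.norm_exp, Complex.norm_exp, Real.exp_le_exp, Complex.sub_re, Complex.neg_re,
    Complex.neg_re, Complex.re_mul_ofReal]
  nlinarith [mul_nonneg hB hrβ.le]

/-- Since `A ∫ e^{-Ar} dr = 1`, the difference is `A ∫ (e^{-B r^β} - 1) e^{-Ar} dr`, and the bracket
is at most `|B| r^β`. The case `Re B = 0` is included because the noise may vanish along the family.
-/
theorem norm_mul_integral_exp_sub_one_le {A B : ℂ} (hA : 0 < A.re) (hB : 0 ≤ B.re) {β : ℝ}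
    (hβ : 0 < β) :
    ‖A * (∫ r : ℝ in Set.Ioi 0, Complex.exp (-(B * (r ^ β : ℝ)) - A * r)) - 1‖ ≤
      ‖A‖ * (‖B‖ * ((1 / A.re) ^ (β + 1) * Real.Gamma (β + 1))) := by
  rw [← mul_integral_exp_neg_mul hA, ← mul_sub, norm_mul,
    ← integral_sub (integrableOn_exp_sub hA hB β) (integrableOn_exp_neg_mul hA),
    ← Real.integral_rpow_mul_exp_neg_mul_Ioi (by linarith) hA, ← integral_const_mul]
  gcongr
  refine norm_integral_le_of_norm_le
    ((integrableOn_rpow_mul_exp_neg_mul (by linarith) hA).const_mul _) ?_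
  filter_upwards [ae_restrict_mem measurableSet_Ioi] with r hr
  have hr : 0 < r := hr
  have hrβ : 0 < r ^ β := Real.rpow_pos_of_pos hr β
  have h1 := norm_exp_neg_sub_one_le (z := B * (r ^ β : ℝ))
    (by rw [Complex.re_mul_ofReal]; positivity)
  have h2 : Complex.exp (-(B * (r ^ β : ℝ)) - A * r) - Complex.exp (-(A * r)) =
      (Complex.exp (-(B * (r ^ β : ℝ))) - 1) * Complex.exp (-(A * r)) := by
    rw [sub_mul, one_mul, ← Complex.exp_add, sub_eq_add_neg (-(B * _))]
  have h3 : ‖Complex.exp (-(A * r))‖ = Real.exp (-(A.re * r)) := by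
    rw [Complex.norm_exp, Complex.neg_re, Complex.re_mul_ofReal]
  rw [norm_mul, Complex.norm_real, Real.norm_of_nonneg hrβ.le] at h1
  rw [h2, norm_mul, h3, add_sub_cancel_right, ← mul_assoc]
  gcongr

/-! ### The function `φ_k` -/

theorem interfCoeff_nonneg {N : ℕ} {α P ρI : ℝ} (hα : 2 < α) (hP : 0 < P) (hρ : 0 ≤ ρI)
    (u : EuclideanSpace ℂ (Fin N)) : 0 ≤ interfCoeff α P ρI u := by
  have h : 0 < 1 - 2 / α := by rw [sub_pos, div_lt_one (by linarith)]; exact hα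
  have := Real.Gamma_pos_of_pos h
  unfold interfCoeff
  positivity

section Denominator

variable {c lam α ω : ℝ} {w : ℂ}

theorem re_cpow_two_div_pos (hα : 2 < α) (hw : 0 < w.re) : 0 < (w ^ ((2 / α : ℝ) : ℂ)).re :=
  re_cpow_ofReal_pos hw (by positivity) ((div_le_one (by linarith)).2 hα.le)

theorem le_denom_re (hα : 2 < α) (hω : 0 ≤ ω) (hw : 0 < w.re) :
    2 * c ≤ (denom c α ω w).re := by
  have h : (denom c α ω w).re = 2 * c + ω * (w ^ ((2 / α : ℝ) : ℂ)).re := by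
    simp [denom]
  rw [h]
  have := mul_nonneg hω (re_cpow_two_div_pos hα hw).le
  linarith

theorem re_div_norm_le_denom (hc : 0 < c) (hα : 2 < α) (hω : 0 ≤ ω) (hw : 0 < w.re) :
    (w ^ ((2 / α : ℝ) : ℂ)).re / ‖w ^ ((2 / α : ℝ) : ℂ)‖ ≤
      (denom c α ω w).re / ‖denom c α ω w‖ := by
  have := re_div_norm_le_re_div_norm_add (p := 2 * c) (by positivity) hω
    (re_cpow_two_div_pos hα hw)
  simpa [denom] using this

theorem abs_arg_denom_le (hc : 0 < c) (hα : 2 < α) (hω : 0 ≤ ω) (hw : 0 < w.re) :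
    α / 2 * |(denom c α ω w).arg| ≤ |w.arg| := by
  have hw0 : w ≠ 0 := by rintro rfl; simp at hw
  have hζ0 : w ^ ((2 / α : ℝ) : ℂ) ≠ 0 := by simp [Complex.cpow_eq_zero_iff, hw0]
  have hd0 : denom c α ω w ≠ 0 := by
    intro h
    have := le_denom_re (c := c) hα hω hw
    rw [h, Complex.zero_re] at this
    linarith
  have hα0 : 0 < α := by linarith
  have hη : |2 / α| ≤ 1 := by rw [abs_of_nonneg (by positivity)]; exact (div_le_one hα0).2 hα.le
  have h1 := abs_arg_le_of_re_div_norm_le hd0 hζ0 (re_div_norm_le_denom hc hα hω hw)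
  have harg : |w.arg| < Real.pi / 2 := Complex.abs_arg_lt_pi_div_two_iff.2 (Or.inl hw)
  rw [arg_cpow_ofReal hw0, abs_mul, abs_of_nonneg (by positivity : 0 ≤ 2 / α)] at h1
  · calc α / 2 * |(denom c α ω w).arg| ≤ α / 2 * (2 / α * |w.arg|) := by gcongr
      _ = |w.arg| := by field_simp
  · rw [abs_mul]
    have := mul_le_of_le_one_left (abs_nonneg w.arg) hη
    linarith [Real.pi_pos]

theorem re_ofReal_mul_denom_pos (hc : 0 < c) (hlam : 0 < lam) (hα : 2 < α) (hω : 0 ≤ ω)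
    (hw : 0 < w.re) : 0 < (((Real.pi * lam : ℝ) : ℂ) * denom c α ω w).re := by
  rw [Complex.re_ofReal_mul]
  have := le_denom_re (c := c) hα hω hw
  have : 0 < (denom c α ω w).re := by linarith
  have := Real.pi_pos
  positivity

/-- The bound is free of `ω`: one factor `|A| / Re A` is controlled by the same ratio for `w^{2/α}`,
the remaining power by `Re A ≥ 2cπλ`. -/
theorem norm_mul_one_div_re_rpow_le (hc : 0 < c) (hlam : 0 < lam) (hα : 2 < α) (hω : 0 ≤ ω)
    (hw : 0 < w.re) {β : ℝ} (hβ : 0 < β) :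
    ‖((Real.pi * lam : ℝ) : ℂ) * denom c α ω w‖ *
        (1 / (((Real.pi * lam : ℝ) : ℂ) * denom c α ω w).re) ^ (β + 1) ≤
      ‖w ^ ((2 / α : ℝ) : ℂ)‖ / (w ^ ((2 / α : ℝ) : ℂ)).re *
        (1 / (Real.pi * lam * (2 * c))) ^ β := by
  have hπ := Real.pi_pos
  have hA := re_ofReal_mul_denom_pos hc hlam hα hω hw
  have hζ := re_cpow_two_div_pos hα hw
  have hle := le_denom_re (c := c) hα hω hw
  have hratio := re_div_norm_le_denom hc hα hω hw
  have hζn : 0 < ‖w ^ ((2 / α : ℝ) : ℂ)‖ := hζ.trans_le (Complex.re_le_norm _)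
  have hd : 0 < (denom c α ω w).re := by linarith
  have hdn : 0 < ‖denom c α ω w‖ := hd.trans_le (Complex.re_le_norm _)
  have h1 : ‖denom c α ω w‖ / (denom c α ω w).re ≤
      ‖w ^ ((2 / α : ℝ) : ℂ)‖ / (w ^ ((2 / α : ℝ) : ℂ)).re := by
    have := one_div_le_one_div_of_le (by positivity) hratio
    rwa [one_div_div, one_div_div] at this
  rw [Real.rpow_add_one (by positivity), mul_left_comm, mul_comm, norm_mul, Complex.norm_real,
    Real.norm_of_nonneg (by positivity), Complex.re_ofReal_mul]
  have h2 : Real.pi * lam * ‖denom c α ω w‖ * (1 / (Real.pi * lam * (denom c α ω w).re)) =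
      ‖denom c α ω w‖ / (denom c α ω w).re := by
    field_simp
  rw [h2]
  gcongr

end Denominator

section Phi

variable {N : ℕ} {c lam α P ρI σ : ℝ} {u : EuclideanSpace ℂ (Fin N)} {w : ℂ}

theorem measurable_phiIntegrand : Measurable (phiIntegrand lam α P ρI σ u w) := by
  unfold phiIntegrand pathLoss
  fun_prop

theorem phiIntegrand_of_pos {d : ℝ} (hd : 0 < d) :
    phiIntegrand lam α P ρI σ u w d =
      Complex.exp (-(((noisePower σ u / P : ℝ) : ℂ) * w * ((d ^ α : ℝ) : ℂ)) -
        ((Real.pi * lam * interfCoeff α P ρI u * d ^ 2 : ℝ) : ℂ) * w ^ ((2 / α : ℝ) : ℂ)) := by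
  have h : noisePower σ u / (P * pathLoss α d) = noisePower σ u / P * d ^ α := by
    rw [pathLoss, Real.rpow_neg hd.le, ← div_div, div_inv_eq_mul]
  rw [phiIntegrand, h]
  congr 2
  push_cast
  ring

theorem norm_phiIntegrand_le_one (hlam : 0 < lam) (hα : 2 < α) (hP : 0 < P) (hρ : 0 ≤ ρI)
    (hw : 0 < w.re) {d : ℝ} (hd : 0 < d) : ‖phiIntegrand lam α P ρI σ u w d‖ ≤ 1 := by
  have h1 : 0 ≤ noisePower σ u / P := by unfold noisePower; positivity
  have h2 := interfCoeff_nonneg hα hP hρ u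
  have h3 := re_cpow_two_div_pos hα hw
  have h4 : 0 < d ^ α := Real.rpow_pos_of_pos hd α
  have hπ := Real.pi_pos
  rw [phiIntegrand_of_pos hd, Complex.norm_exp, Real.exp_le_one_iff, Complex.sub_re,
    Complex.neg_re, Complex.re_mul_ofReal, Complex.re_ofReal_mul, Complex.re_ofReal_mul]
  have h5 : 0 ≤ noisePower σ u / P * w.re * d ^ α := by positivity
  have h6 : 0 ≤ Real.pi * lam * interfCoeff α P ρI u * d ^ 2 * (w ^ ((2 / α : ℝ) : ℂ)).re := by
    positivity
  linarith

theorem integrable_phiIntegrand_distLaw (hc : 0 < c) (hlam : 0 < lam) (hα : 2 < α) (hP : 0 < P)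
    (hρ : 0 ≤ ρI) (hw : 0 < w.re) :
    Integrable (phiIntegrand lam α P ρI σ u w) (distLaw c lam) := by
  have := isProbabilityMeasure_distLaw hc hlam
  refine Integrable.of_bound measurable_phiIntegrand.aestronglyMeasurable 1 ?_
  -- The bound by `1` is only available for `d > 0`, which holds almost surely.
  have h : ∀ᵐ d ∂distLaw c lam, d ∉ Set.Iic (0 : ℝ) :=
    measure_eq_zero_iff_ae_notMem.1 (distLaw_Iic_zero c lam)
  filter_upwards [h] with d hd
  exact norm_phiIntegrand_le_one hlam hα hP hρ hw (not_le.1 hd)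

/-- Substituting `r = x²` absorbs the factor `x` of the density; its exponent `2cλπ r` merges with
the interference term into `πλ (2c + ω w^{2/α}) r`. -/
theorem integral_phiIntegrand_distLaw (hc : 0 < c) (hlam : 0 < lam) :
    ∫ d, phiIntegrand lam α P ρI σ u w d ∂distLaw (2 * c) lam =
      ((2 * c * lam * Real.pi : ℝ) : ℂ) * ∫ r : ℝ in Set.Ioi 0,
        Complex.exp (-(((noisePower σ u / P : ℝ) : ℂ) * w * (r ^ (α / 2) : ℝ)) -
          ((Real.pi * lam : ℝ) : ℂ) * denom c α (interfCoeff α P ρI u) w * r) := by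
  rw [distLaw, integral_withDensity_eq_integral_toReal_smul
    (measurable_fd _ _).ennreal_ofReal (ae_of_all _ fun _ => ENNReal.ofReal_lt_top),
    ← setIntegral_eq_integral_of_forall_compl_eq_zero (s := Set.Ioi 0) (fun x hx => by
      simp [fd_of_nonpos (c := 2 * c) (lam := lam) (not_lt.1 hx)]),
    ← integral_const_mul, ← integral_comp_rpow_Ioi_of_pos (g := fun r : ℝ => _ * _) two_pos]
  refine setIntegral_congr_fun measurableSet_Ioi fun x hx => ?_
  have hx : 0 < x := hx
  have h1 : (x ^ (2 : ℝ)) ^ (α / 2) = x ^ α := by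
    rw [← Real.rpow_mul hx.le]
    congr 1
    ring
  have h2 : x ^ ((2 : ℝ) - 1) = x := by norm_num
  simp only [Complex.real_smul]
  rw [ENNReal.toReal_ofReal (fd_nonneg (by positivity) hlam x), fd_of_nonneg hx.le,
    phiIntegrand_of_pos hx, h1, h2, Real.rpow_two]
  push_cast
  rw [mul_assoc (2 * (2 * (c : ℂ)) * lam * Real.pi * x), ← Complex.exp_add,
    ← mul_assoc (2 * (x : ℂ)), denom]
  congr 1
  · ring
  · congr 1
    push_cast
    ring

theorem phi_eq {Ω : Type*} [MeasurableSpace Ω] {μ : Measure Ω} {d : Ω → ℝ} (hd : Measurable d)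
    (hlaw : μ.map d = distLaw (2 * c) lam) (hc : 0 < c) (hlam : 0 < lam) (hα : 2 < α) (hP : 0 < P)
    (hρ : 0 ≤ ρI) (hw : 0 < w.re) :
    phi μ d lam α P ρI σ u w = 2 * (c : ℂ) / denom c α (interfCoeff α P ρI u) w *
      (((Real.pi * lam : ℝ) : ℂ) * denom c α (interfCoeff α P ρI u) w * ∫ r : ℝ in Set.Ioi 0,
        Complex.exp (-(((noisePower σ u / P : ℝ) : ℂ) * w * (r ^ (α / 2) : ℝ)) -
          ((Real.pi * lam : ℝ) : ℂ) * denom c α (interfCoeff α P ρI u) w * r)) := by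
  have hd0 : denom c α (interfCoeff α P ρI u) w ≠ 0 := by
    intro h
    have := le_denom_re (c := c) hα (interfCoeff_nonneg hα hP hρ u) hw
    rw [h, Complex.zero_re] at this
    linarith
  rw [phi, ← integral_map hd.aemeasurable measurable_phiIntegrand.aestronglyMeasurable, hlaw,
    integral_phiIntegrand_distLaw hc hlam]
  push_cast
  field_simp

theorem norm_laplace_sub_one_le (hc : 0 < c) (hlam : 0 < lam) (hα : 2 < α) (hP : 0 < P)
    (hρ : 0 ≤ ρI) (hw : 0 < w.re) :
    ‖((Real.pi * lam : ℝ) : ℂ) * denom c α (interfCoeff α P ρI u) w * (∫ r : ℝ in Set.Ioi 0,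
        Complex.exp (-(((noisePower σ u / P : ℝ) : ℂ) * w * (r ^ (α / 2) : ℝ)) -
          ((Real.pi * lam : ℝ) : ℂ) * denom c α (interfCoeff α P ρI u) w * r)) - 1‖ ≤
      σ ^ 2 / P * (‖u‖ ^ 2 * ‖w‖ * (‖w ^ ((2 / α : ℝ) : ℂ)‖ / (w ^ ((2 / α : ℝ) : ℂ)).re *
        (1 / (Real.pi * lam * (2 * c))) ^ (α / 2) * Real.Gamma (α / 2 + 1))) := by
  have hω := interfCoeff_nonneg hα hP hρ u
  have hb : 0 ≤ noisePower σ u / P := by unfold noisePower; positivity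
  have hG : 0 < Real.Gamma (α / 2 + 1) := Real.Gamma_pos_of_pos (by linarith)
  refine (norm_mul_integral_exp_sub_one_le (re_ofReal_mul_denom_pos hc hlam hα hω hw)
    (by rw [Complex.re_ofReal_mul]; positivity) (β := α / 2) (by linarith)).trans ?_
  have h := norm_mul_one_div_re_rpow_le hc hlam hα hω hw (β := α / 2) (by linarith)
  have hB : ‖((noisePower σ u / P : ℝ) : ℂ) * w‖ = σ ^ 2 / P * (‖u‖ ^ 2 * ‖w‖) := by
    rw [norm_mul, Complex.norm_real, Real.norm_of_nonneg hb, noisePower]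
    ring
  rw [hB, mul_left_comm, ← mul_assoc ‖_‖, mul_assoc (σ ^ 2 / P)]
  gcongr

end Phi

end NomaNearUser

open NomaNearUser in
theorem theorem3 {Ω : Type*} [MeasurableSpace Ω] (μ : Measure Ω) [IsProbabilityMeasure μ]
    {K N : ℕ} (c lam α : ℝ) (hc : 0 < c) (hlam : 0 < lam) (hα : 2 < α)
    (D : Fin (2 * K) → Ω → ℝ) (g : Ω → Grouping K) (hgroup : IsRandomGrouping μ K c lam D g)
    (k : Fin K) (u : EuclideanSpace ℂ (Fin N)) (hu : u ≠ 0) :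
    -- the density of the near user's distance
    μ.map (nearDist D g k) = (volume : Measure ℝ).withDensity
        (fun x => ENNReal.ofReal (2 * (1 - Fd c lam x) * fd c lam x)) ∧
    -- the closed form, with a convergent Mellin-Barnes integral on every admissible line
    (∀ P ρI σ : ℝ, 0 < P → 0 ≤ ρI → 0 < σ → ∀ s t : ℂ, 0 < s.re → 0 < t.re →
      Integrable (fun ω => phiIntegrand lam α P ρI σ u (s + t) (nearDist D g k ω)) μ ∧
      (∃ γ : ℝ, FoxSeparates 1 1 ![((0 : ℂ), α / 2)] ![((0 : ℂ), (1 : ℝ))] γ) ∧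
      (∀ γ : ℝ, FoxSeparates 1 1 ![((0 : ℂ), α / 2)] ![((0 : ℂ), (1 : ℝ))] γ →
        Integrable (foxIntegrand 1 1 ![((0 : ℂ), α / 2)] ![((0 : ℂ), (1 : ℝ))] γ
          (foxArg c lam α P ρI σ u (s + t))) volume ∧
        foxLine 1 1 ![((0 : ℂ), α / 2)] ![((0 : ℂ), (1 : ℝ))] γ
            (foxArg c lam α P ρI σ u (s + t)) =
          foxH 1 1 ![((0 : ℂ), α / 2)] ![((0 : ℂ), (1 : ℝ))]
            (foxArg c lam α P ρI σ u (s + t))) ∧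
      phi μ (nearDist D g k) lam α P ρI σ u (s + t) =
        2 * (c : ℂ) / denom c α (interfCoeff α P ρI u) (s + t) *
          foxH 1 1 ![((0 : ℂ), α / 2)] ![((0 : ℂ), (1 : ℝ))]
            (foxArg c lam α P ρI σ u (s + t))) ∧
    -- the interference-limited regime, along any family of parameters with σ² / P → 0
    (∀ s t : ℂ, 0 < s.re → 0 < t.re → ∀ (ι : Type) (l : Filter ι) (P ρI σ : ι → ℝ),
      (∀ i, 0 < P i) → (∀ i, 0 ≤ ρI i) → Tendsto (fun i => σ i ^ 2 / P i) l (𝓝 0) →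
      ((fun i => phi μ (nearDist D g k) lam α (P i) (ρI i) (σ i) u (s + t)) ~[l]
        (fun i => 2 * (c : ℂ) / denom c α (interfCoeff α (P i) (ρI i) u) (s + t))) ∧
      (∀ coeff : ℝ, (∀ i, interfCoeff α (P i) (ρI i) u = coeff) →
        Tendsto (fun i => phi μ (nearDist D g k) lam α (P i) (ρI i) (σ i) u (s + t)) l
          (𝓝 (2 * (c : ℂ) / denom c α coeff (s + t))))) := by
  have hlaw := map_nearDist hc hlam hgroup k
  have hmeas := measurable_nearDist hgroup k
  have hα0 : 0 < α := by linarith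
  refine ⟨?_, ?_, ?_⟩
  · simp_rw [two_mul_one_sub_Fd_mul_fd hc hlam]
    exact hlaw
  · intro P ρI σ hP hρ hσ s t hs ht
    have hw : 0 < (s + t).re := by rw [Complex.add_re]; positivity
    have hω := interfCoeff_nonneg hα hP hρ u
    have hA := re_ofReal_mul_denom_pos hc hlam hα hω hw
    have hb : 0 < noisePower σ u / P := by
      have := norm_pos_iff.2 hu
      unfold noisePower
      positivity
    have hB : 0 < (((noisePower σ u / P : ℝ) : ℂ) * (s + t)).re := by
      rw [Complex.re_ofReal_mul]; positivity
    have harg : |(((noisePower σ u / P : ℝ) : ℂ) * (s + t)).arg| + α / 2 *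
        |(((Real.pi * lam : ℝ) : ℂ) * denom c α (interfCoeff α P ρI u) (s + t)).arg| <
          Real.pi := by
      -- Positive real factors do not change arguments, so the sum is at most `2 |arg (s + t)| < π`.
      rw [Complex.arg_real_mul _ hb, Complex.arg_real_mul _ (mul_pos Real.pi_pos hlam)]
      have h1 := abs_arg_denom_le hc hα hω hw
      have h2 : |(s + t).arg| < Real.pi / 2 := Complex.abs_arg_lt_pi_div_two_iff.2 (Or.inl hw)
      linarith
    refine ⟨?_, exists_foxSeparates hα0, fun γ hγ => ⟨?_, ?_⟩, ?_⟩
    · refine Integrable.comp_measurable (f := nearDist D g k)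
        (g := phiIntegrand lam α P ρI σ u (s + t)) ?_ hmeas
      rw [hlaw]
      exact integrable_phiIntegrand_distLaw (by positivity) hlam hα hP hρ hw
    · exact integrable_foxIntegrand hA hB hα0 harg hγ
    · exact (foxLine_eq hA hB hα0 harg hγ).trans (foxH_eq hA hB hα0 harg).symm
    · rw [phi_eq hmeas hlaw hc hlam hα hP hρ hw, foxArg, foxH_eq hA hB hα0 harg]
  · intro s t hs ht ι l P ρI σ hP hρ hlim
    have hw : 0 < (s + t).re := by rw [Complex.add_re]; positivity
    have hequiv : (fun i => phi μ (nearDist D g k) lam α (P i) (ρI i) (σ i) u (s + t)) ~[l]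
        (fun i => 2 * (c : ℂ) / denom c α (interfCoeff α (P i) (ρI i) u) (s + t)) := by
      -- By `phi_eq` the ratio of the two sides is exactly the normalised Laplace integral, which is
      -- within a constant times `σ²/P` of `1`.
      refine isEquivalent_iff_exists_eq_mul.2 ⟨_, ?_, Eventually.of_forall fun i =>
        (phi_eq hmeas hlaw hc hlam hα (hP i) (hρ i) hw).trans (mul_comm _ _)⟩
      rw [tendsto_iff_norm_sub_tendsto_zero]
      refine squeeze_zero (fun _ => norm_nonneg _)
        (fun i => norm_laplace_sub_one_le hc hlam hα (hP i) (hρ i) hw) ?_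
      simpa using hlim.mul_const _
    refine ⟨hequiv, fun coeff hcoeff => ?_⟩
    simp_rw [hcoeff] at hequiv
    exact hequiv.symm.tendsto_nhds tendsto_const_nhds
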